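/- Let $n,m\ge 1$, let $B_\rho\subset\mathbb R^n$ be the open ball of radius $\rho$ centred at the origin, and let $f^1$ be the first vector of the canonical basis of $\mathbb R^m$. For $U=(u^1,\dots,u^m):B_1\to\mathbb R^m$ put $B_1(U):=B_1\cap\{|U|>0\}$ and $F(U):=B_1\cap\partial B_1(U)$. A continuous $U$ is a viscosity solution in $B_1$ of $$\Delta U=0\ \text{ in } B_1(U),\qquad |\nabla|U||=1\ \text{ on } F(U),$$ if every $u^i$ is harmonic in $B_1(U)$ and, for every $x_0\in F(U)$ and every function $\varphi$ of class $C^2$ near $x_0$: (1) if $|\nabla\varphi(x_0)|>1$, then for no unit vector $f\in\mathbb R^m$ does $\varphi$ touch $\langle U,f\rangle$ by below at $x_0$ (that is, $\varphi\le\langle U,f\rangle$ near $x_0$ with equality at $x_0$); (2) if $0<|\nabla\varphi(x_0)|<1$, then $\varphi^+=\max(\varphi,0)$ does not touch $|U|$ by above at $x_0$ (that is, it is not the case that $|U|\le\varphi^+$ near $x_0$ with equality at $x_0$). Then there are constants $\bar\varepsilon>0$, $C>0$, $\alpha\in(0,1)$ and radii $r_\varepsilon>0$ ($\varepsilon>0$)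 with $r_\varepsilon\to0$ as $\varepsilon\to0^+$, all depending only on $n$ and $m$, such that the following holds. Let $0<\varepsilon\le\bar\varepsilon$ and let $U$ be a viscosity solution in $B_1$ with $$|U-f^1x_n^+|\le\varepsilon\ \text{ in } B_1,\qquad |U|\equiv0\ \text{ in } B_1\cap\{x_n<-\varepsilon\}.$$ On $B_1(U)\cup F(U)$ let $$\tilde u^1:=\frac{u^1-x_n}{\varepsilon},\qquad \widetilde{|U|}:=\frac{|U|-x_n}{\varepsilon}.$$ Then for every $x_0\in B_{1/2}\cap(B_1(U)\cup F(U))$ and every $x\in B_1(U)\cup F(U)$ with $|x-x_0|\ge r_\varepsilon$, $$|\tilde u^1(x)-\tilde u^1(x_0)|\le C|x-x_0|^\alpha,\qquad \big|\widetilde{|U|}(x)-\widetilde{|U|}(x_0)\big|\le C|x-x_0|^\alpha .$$ -/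

import Mathlib

open Set Filter Topology

namespace VectorialBernoulli

variable {E : Type*} [NormedAddCommGroup E] [InnerProductSpace ℝ E] [FiniteDimensional ℝ E]
variable {F : Type*} [NormedAddCommGroup F] [InnerProductSpace ℝ F]

/-- The positivity set `Ω(U) = Ω ∩ {|U| > 0}`. -/
def posSet (Ω : Set E) (U : E → F) : Set E := {x | x ∈ Ω ∧ 0 < ‖U x‖}

/-- The free boundary `F(U) = Ω ∩ ∂Ω(U)`. -/
def freeBoundary (Ω : Set E) (U : E → F) : Set E := Ω ∩ frontier (posSet Ω U)

/-- `φ` touches `w` by below at `x₀`. -/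
def TouchesBelow (φ w : E → ℝ) (x₀ : E) : Prop :=
  φ x₀ = w x₀ ∧ ∀ᶠ x in 𝓝 x₀, φ x ≤ w x

/-- `φ` touches `w` by above at `x₀`. -/
def TouchesAbove (φ w : E → ℝ) (x₀ : E) : Prop :=
  φ x₀ = w x₀ ∧ ∀ᶠ x in 𝓝 x₀, w x ≤ φ x

/-- Viscosity solutions in the open set `Ω` of the vectorial one-phase problem
`Δ U = 0` in `Ω(U)`, `|∇|U|| = 1` on `F(U)`, for a map `U = (u¹, …, uᵐ)` (only the values of `U`
on `Ω` matter).

As usual for one-phase problems, touching the nonnegative function `|U|` by above at a free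
boundary point is understood for the positive part `φ⁺` of the test function, i.e. `|U| ≤ φ`
is required near `x₀` only where `|U| > 0`. (A `φ` with `φ x₀ = 0` and `∇φ(x₀) ≠ 0` is negative
somewhere near `x₀`, so it never lies above `|U|` in a full neighbourhood.) -/
structure IsViscositySolution {m : ℕ} (Ω : Set E) (U : E → EuclideanSpace ℝ (Fin m)) :
    Prop where
  continuousOn : ContinuousOn U Ω
  harmonic : ∀ i : Fin m, InnerProductSpace.HarmonicOnNhd (fun x => U x i) (posSet Ω U)
  not_touches_below : ∀ x₀ ∈ freeBoundary Ω U, ∀ φ : E → ℝ, ContDiffAt ℝ 2 φ x₀ →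
    1 < ‖gradient φ x₀‖ →
    ∀ f : EuclideanSpace ℝ (Fin m), ‖f‖ = 1 →
      ¬ TouchesBelow φ (fun x => inner ℝ (U x) f) x₀
  not_touches_above : ∀ x₀ ∈ freeBoundary Ω U, ∀ φ : E → ℝ, ContDiffAt ℝ 2 φ x₀ →
    gradient φ x₀ ≠ 0 → ‖gradient φ x₀‖ < 1 →
      ¬ TouchesAbove (fun x => max (φ x) 0) (fun x => ‖U x‖) x₀

/-- The last coordinate `x_n` of a point; the dimension is written `n + 1` so that it is
positive. -/
def lastCoord {n : ℕ} (x : EuclideanSpace ℝ (Fin (n + 1))) : ℝ := x (Fin.last n)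

/-- The flatness assumption `|U - f¹ x_n⁺| ≤ ε` in `B_1`, where `f¹` is the first vector of the
canonical basis of the target space. -/
def IsFlat {n m : ℕ} (ε : ℝ)
    (U : EuclideanSpace ℝ (Fin (n + 1)) → EuclideanSpace ℝ (Fin (m + 1))) : Prop :=
  ∀ x ∈ Metric.ball (0 : EuclideanSpace ℝ (Fin (n + 1))) 1,
    ‖U x - max (lastCoord x) 0 • EuclideanSpace.single (0 : Fin (m + 1)) (1 : ℝ)‖ ≤ ε

/-- `|U| ≡ 0` in `B_1 ∩ {x_n < -ε}`. -/
def VanishesBelow {n m : ℕ} (ε : ℝ)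
    (U : EuclideanSpace ℝ (Fin (n + 1)) → EuclideanSpace ℝ (Fin (m + 1))) : Prop :=
  ∀ x ∈ Metric.ball (0 : EuclideanSpace ℝ (Fin (n + 1))) 1, lastCoord x < -ε → ‖U x‖ = 0

/-- The rescaling `(u¹ - x_n) / ε` of the first component. -/
noncomputable def rescaledFirst {n m : ℕ} (ε : ℝ)
    (U : EuclideanSpace ℝ (Fin (n + 1)) → EuclideanSpace ℝ (Fin (m + 1)))
    (x : EuclideanSpace ℝ (Fin (n + 1))) : ℝ :=
  (U x 0 - lastCoord x) / ε

/-- The rescaling `(|U| - x_n) / ε` of the norm. -/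
noncomputable def rescaledNorm {n m : ℕ} (ε : ℝ)
    (U : EuclideanSpace ℝ (Fin (n + 1)) → EuclideanSpace ℝ (Fin (m + 1)))
    (x : EuclideanSpace ℝ (Fin (n + 1))) : ℝ :=
  (‖U x‖ - lastCoord x) / ε

/-- The function `g`, considered on the set `D`, has the Hölder modulus of continuity
`t ↦ C t ^ α` at `x₀`, outside the ball of radius `r` about `x₀`. -/
def HolderAtOutside (D : Set E) (g : E → ℝ) (C α r : ℝ) (x₀ : E) : Prop :=
  ∀ x ∈ D, r ≤ ‖x - x₀‖ → |g x - g x₀| ≤ C * ‖x - x₀‖ ^ α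

end VectorialBernoulli

/-! The estimate is a partial Harnack inequality iterated on dyadic balls. Flatness traps the
solution between two planes: x_n + a ≤ u¹, and |U| ≤ x_n + b on the closure of the positivity set.
`exists_harnack_constants` shrinks b - a by a fixed factor 1 - c when the radius is halved. It
measures the gap u¹ - (x_n + a) at a point p lifted above x₀. If the gap is at least half of b - a,
the interior estimate `harmonic_sub_le` spreads it to a small ball, and a strict subsolution pushes
u¹ up. Otherwise |U|, which exceeds u¹ only slightly near p, is pushed down by a strict
supersolution. In the comparison lemmas `IsViscositySolution.strict_subsolution_le` and
`IsViscositySolution.norm_le_strict_supersolution`, contact is excluded by the sign of the Laplacian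
off the free boundary and by the size of the gradient on it.

The remaining components of U enter only through |U|² ≤ (u¹)² + ε². The resulting error, of order
ε²/r, is absorbed by b - a as long as ε is small compared with r². In `exists_iterated_bounds` this
is the condition ε 4^k ≤ c₂, so the iteration runs down to radii of order √ε, whence r_ε. Decay (1 -
c)^k at radius 2^(-k) is Hölder continuity with exponent -log₂(1 - c). -/

namespace VectorialBernoulli

/-! ### Laplacians along orthonormal lines, the maximum principle, explicit Laplacians -/

section Calculus

open InnerProductSpace

variable {E : Type*} [NormedAddCommGroup E] [InnerProductSpace ℝ E] [FiniteDimensional ℝ E]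

/-- The Laplacian is the sum of the second derivatives along the lines spanned by an orthonormal
basis. -/
theorem laplacian_eq_sum_deriv_deriv {ι : Type*} [Fintype ι] (b : OrthonormalBasis ι ℝ E)
    {f : E → ℝ} {x : E} (hf : ContDiffAt ℝ 2 f x) :
    Laplacian.laplacian f x = ∑ i, deriv (deriv fun t : ℝ => f (x + t • b i)) 0 := by
  rw [laplacian_eq_iteratedFDeriv_orthonormalBasis f b]
  refine Finset.sum_congr rfl fun i _ => ?_
  rw [iteratedFDeriv_two_apply]
  have hline : ∀ t : ℝ, HasDerivAt (fun t : ℝ => x + t • b i) (b i) t := fun t => by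
    simpa using ((hasDerivAt_id t).smul_const (b i)).const_add x
  have hev : ∀ᶠ y in 𝓝 x, DifferentiableAt ℝ f y :=
    (hf.eventually (by simp)).mono fun y hy => hy.differentiableAt (by norm_num)
  have hx0 : x + (0 : ℝ) • b i = x := by simp
  have htend : Tendsto (fun t : ℝ => x + t • b i) (𝓝 0) (𝓝 x) := by
    have := (hline 0).continuousAt.tendsto
    rwa [hx0] at this
  have h1 : deriv (fun t : ℝ => f (x + t • b i)) =ᶠ[𝓝 0]
      fun t => fderiv ℝ f (x + t • b i) (b i) := by
    filter_upwards [htend.eventually hev] with t ht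
    have h := ht.hasFDerivAt.comp_hasDerivAt t (hline t)
    exact h.deriv
  rw [h1.deriv_eq]
  have h2 : HasFDerivAt (fderiv ℝ f) (fderiv ℝ (fderiv ℝ f) x) (x + (0 : ℝ) • b i) := by
    rw [hx0]
    exact ((hf.fderiv_right (m := 1) (by norm_num)).differentiableAt (by norm_num)).hasFDerivAt
  have h3 : HasDerivAt (fun t : ℝ => fderiv ℝ f (x + t • b i))
      (fderiv ℝ (fderiv ℝ f) x (b i)) 0 := h2.comp_hasDerivAt (0 : ℝ) (hline 0)
  have h4 : HasDerivAt (fun t : ℝ => fderiv ℝ f (x + t • b i) (b i))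
      (fderiv ℝ (fderiv ℝ f) x (b i) (b i)) 0 := by
    simpa using h3.clm_apply (hasDerivAt_const (0 : ℝ) (b i))
  exact h4.deriv.symm

/-- A positive second derivative would make the point a local minimum as well, hence the function
locally constant, with second derivative zero. -/
theorem deriv_deriv_nonpos_of_isLocalMax {g : ℝ → ℝ} {t : ℝ} (hc : ContinuousAt g t)
    (h : IsLocalMax g t) : deriv (deriv g) t ≤ 0 := by
  by_contra! hpos
  have hmin := isLocalMin_of_deriv_deriv_pos hpos h.deriv_eq_zero hc
  have hconst : g =ᶠ[𝓝 t] fun _ => g t := by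
    filter_upwards [h, hmin] with s h1 h2 using le_antisymm h1 h2
  have : deriv (deriv g) t = 0 := by
    rw [hconst.deriv.deriv_eq]; simp
  exact hpos.ne' this

theorem laplacian_nonpos_of_isLocalMax {f : E → ℝ} {x : E} (hf : ContDiffAt ℝ 2 f x)
    (h : IsLocalMax f x) : Laplacian.laplacian f x ≤ 0 := by
  rw [laplacian_eq_sum_deriv_deriv (stdOrthonormalBasis ℝ E) hf]
  refine Finset.sum_nonpos fun i _ => ?_
  set v := stdOrthonormalBasis ℝ E i
  have hcont : ContinuousAt (fun t : ℝ => x + t • v) 0 := by fun_prop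
  have htend : Tendsto (fun t : ℝ => x + t • v) (𝓝 0) (𝓝 x) := by
    simpa [ContinuousAt] using hcont
  refine deriv_deriv_nonpos_of_isLocalMax ?_ ?_
  · have : ContinuousAt f (x + (0 : ℝ) • v) := by simpa using hf.continuousAt
    exact ContinuousAt.comp (f := fun t : ℝ => x + t • v) this hcont
  · filter_upwards [htend.eventually h] with t ht
    simpa using ht

/-- A function with positive Laplacian does not touch a harmonic function from below. -/
theorem not_isLocalMax_sub_of_harmonicAt {w u : E → ℝ} {x : E} (hw : ContDiffAt ℝ 2 w x)
    (hpos : 0 < Laplacian.laplacian w x) (hu : HarmonicAt u x) :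
    ¬ IsLocalMax (w - u) x := fun h => by
  have : Laplacian.laplacian (w - u) x ≤ 0 := laplacian_nonpos_of_isLocalMax (hw.sub hu.1) h
  rw [hw.laplacian_sub hu.1, hu.2.eq_of_nhds] at this
  simp at this
  linarith

/-- An isometry carries an orthonormal basis to an orthonormal basis, and the Laplacian may be
computed in either. -/
theorem laplacian_comp_add_isometry {f : E → ℝ} (z : E) (σ : E ≃ₗᵢ[ℝ] E) {x : E}
    (hf : ContDiffAt ℝ 2 f (z + σ x)) :
    Laplacian.laplacian (fun y => f (z + σ y)) x = Laplacian.laplacian f (z + σ x) := by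
  have hcomp : ContDiffAt ℝ 2 (fun y => f (z + σ y)) x :=
    ContDiffAt.comp x (f := fun y => z + σ y) hf
      (contDiff_const.add σ.toContinuousLinearEquiv.contDiff).contDiffAt
  rw [laplacian_eq_sum_deriv_deriv (stdOrthonormalBasis ℝ E) hcomp,
    laplacian_eq_sum_deriv_deriv ((stdOrthonormalBasis ℝ E).map σ) hf]
  simp [add_assoc]

theorem laplacian_inner_add_const (e : E) (c : ℝ) (x : E) :
    Laplacian.laplacian (fun y : E => inner ℝ y e + c) x = 0 := by
  have hcd : ContDiffAt ℝ 2 (fun y : E => inner ℝ y e + c) x :=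
    ((contDiff_id.inner ℝ contDiff_const).add contDiff_const).contDiffAt
  rw [laplacian_eq_sum_deriv_deriv (stdOrthonormalBasis ℝ E) hcd]
  refine Finset.sum_eq_zero fun i _ => ?_
  simp [inner_add_left, inner_smul_left]

theorem harmonicAt_inner_add_const (e : E) (c : ℝ) (x : E) :
    HarmonicAt (fun y : E => inner ℝ y e + c) x :=
  ⟨((contDiff_id.inner ℝ contDiff_const).add contDiff_const).contDiffAt,
    Eventually.of_forall fun y => laplacian_inner_add_const e c y⟩

theorem deriv_deriv_quadratic (a b c t : ℝ) :
    deriv (deriv fun t : ℝ => a + b * t + c * t ^ 2) t = 2 * c := by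
  have h : (deriv fun t : ℝ => a + b * t + c * t ^ 2) = fun t => b + 2 * c * t := by
    ext t
    have := (((hasDerivAt_id t).const_mul b).const_add a).add (((hasDerivAt_id t).pow 2).const_mul c)
    refine HasDerivAt.deriv (this.congr_deriv ?_)
    simp; ring
  rw [h]
  simp

theorem deriv_deriv_exp_quadratic (a b c : ℝ) :
    deriv (deriv fun t : ℝ => Real.exp (a + b * t + c * t ^ 2)) 0
      = (b ^ 2 + 2 * c) * Real.exp a := by
  have hq : ∀ t : ℝ, HasDerivAt (fun t : ℝ => a + b * t + c * t ^ 2) (b + 2 * c * t) t := by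
    intro t
    have := (((hasDerivAt_id t).const_mul b).const_add a).add (((hasDerivAt_id t).pow 2).const_mul c)
    refine this.congr_deriv ?_
    simp; ring
  have h : (deriv fun t : ℝ => Real.exp (a + b * t + c * t ^ 2)) =
      fun t => Real.exp (a + b * t + c * t ^ 2) * (b + 2 * c * t) := by
    ext t
    exact (hq t).exp.deriv
  rw [h]
  have hl : HasDerivAt (fun t : ℝ => b + 2 * c * t) (2 * c) 0 := by
    simpa using ((hasDerivAt_id (0 : ℝ)).const_mul (2 * c)).const_add b
  have hm : HasDerivAt (fun t : ℝ => Real.exp (a + b * t + c * t ^ 2) * (b + 2 * c * t))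
      ((b ^ 2 + 2 * c) * Real.exp a) 0 := by
    refine ((hq 0).exp.mul hl).congr_deriv ?_
    simp; ring
  exact hm.deriv

omit [FiniteDimensional ℝ E] in
theorem sum_sq_inner_basis {ι : Type*} [Fintype ι] (b : OrthonormalBasis ι ℝ E) (x : E) :
    ∑ i, inner ℝ x (b i) ^ 2 = ‖x‖ ^ 2 := by
  simpa using b.sum_sq_norm_inner_left x

omit [FiniteDimensional ℝ E] in
theorem contDiff_quadratic (K L M : ℝ) (e : E) : ContDiff ℝ 2
    (fun y : E => K * ‖y‖ ^ 2 + L * inner ℝ y e - M * inner ℝ y e ^ 2) := by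
  have h1 : ContDiff ℝ 2 fun y : E => inner ℝ y e := contDiff_id.inner ℝ contDiff_const
  have h2 : ContDiff ℝ 2 fun y : E => ‖y‖ ^ 2 := contDiff_id.norm_sq ℝ
  exact ((contDiff_const.mul h2).add (contDiff_const.mul h1)).sub (contDiff_const.mul (h1.pow 2))

theorem laplacian_quadratic (K L M : ℝ) {e : E} (he : ‖e‖ = 1) (x : E) :
    Laplacian.laplacian
      (fun y : E => K * ‖y‖ ^ 2 + L * inner ℝ y e - M * inner ℝ y e ^ 2) x
      = 2 * K * Module.finrank ℝ E - 2 * M := by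
  set b := stdOrthonormalBasis ℝ E
  have hcd : ContDiffAt ℝ 2
      (fun y : E => K * ‖y‖ ^ 2 + L * inner ℝ y e - M * inner ℝ y e ^ 2) x :=
    (contDiff_quadratic K L M e).contDiffAt
  rw [laplacian_eq_sum_deriv_deriv b hcd]
  have key : ∀ i, deriv (deriv fun t : ℝ => K * ‖x + t • b i‖ ^ 2 + L * inner ℝ (x + t • b i) e
      - M * inner ℝ (x + t • b i) e ^ 2) 0 = 2 * K - 2 * M * inner ℝ e (b i) ^ 2 := by
    intro i
    have hfun : (fun t : ℝ => K * ‖x + t • b i‖ ^ 2 + L * inner ℝ (x + t • b i) e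
      - M * inner ℝ (x + t • b i) e ^ 2) = fun t : ℝ =>
        (K * ‖x‖ ^ 2 + L * inner ℝ x e - M * inner ℝ x e ^ 2) +
        (2 * K * inner ℝ x (b i) + L * inner ℝ e (b i)
          - 2 * M * inner ℝ x e * inner ℝ e (b i)) * t
        + (K - M * inner ℝ e (b i) ^ 2) * t ^ 2 := by
      ext t
      rw [norm_add_sq_real, norm_smul, b.norm_eq_one i]
      simp only [inner_add_left, inner_smul_left, inner_smul_right, real_inner_comm e (b i)]
      simp
      ring
    rw [hfun, deriv_deriv_quadratic]
    ring
  simp_rw [key]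
  rw [Finset.sum_sub_distrib, ← Finset.mul_sum (f := fun i => inner ℝ e (b i) ^ 2),
    sum_sq_inner_basis, he]
  simp
  ring

omit [FiniteDimensional ℝ E] in
theorem contDiff_gaussian (A : ℝ) (p : E) :
    ContDiff ℝ 2 (fun y : E => Real.exp (-A * ‖y - p‖ ^ 2)) :=
  (contDiff_const.mul ((contDiff_id.sub contDiff_const).norm_sq ℝ)).exp

theorem laplacian_gaussian (A : ℝ) (p x : E) :
    Laplacian.laplacian (fun y : E => Real.exp (-A * ‖y - p‖ ^ 2)) x
      = (4 * A ^ 2 * ‖x - p‖ ^ 2 - 2 * A * Module.finrank ℝ E) *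
        Real.exp (-A * ‖x - p‖ ^ 2) := by
  set b := stdOrthonormalBasis ℝ E
  have hcd : ContDiffAt ℝ 2 (fun y : E => Real.exp (-A * ‖y - p‖ ^ 2)) x :=
    (contDiff_gaussian A p).contDiffAt
  rw [laplacian_eq_sum_deriv_deriv b hcd]
  have key : ∀ i, deriv (deriv fun t : ℝ => Real.exp (-A * ‖x + t • b i - p‖ ^ 2)) 0
      = (4 * A ^ 2 * inner ℝ (x - p) (b i) ^ 2 - 2 * A) * Real.exp (-A * ‖x - p‖ ^ 2) := by
    intro i
    have hfun : (fun t : ℝ => Real.exp (-A * ‖x + t • b i - p‖ ^ 2)) = fun t : ℝ =>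
        Real.exp (-A * ‖x - p‖ ^ 2 + (-2 * A * inner ℝ (x - p) (b i)) * t + (-A) * t ^ 2) := by
      ext t
      rw [add_sub_right_comm, norm_add_sq_real, norm_smul, b.norm_eq_one i, inner_smul_right]
      congr 1
      simp
      ring
    rw [hfun, deriv_deriv_exp_quadratic]
    ring
  simp_rw [key]
  rw [← Finset.sum_mul, Finset.sum_sub_distrib, ← Finset.mul_sum, sum_sq_inner_basis]
  simp
  ring

end Calculus

/-! ### Interior Lipschitz estimate by reflection and a quadratic barrier -/

section InteriorEstimate

open InnerProductSpace Module

variable {E : Type*} [NormedAddCommGroup E] [InnerProductSpace ℝ E] [FiniteDimensional ℝ E]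

/-- A bounded harmonic function on a half ball that vanishes on the flat part of the boundary is
below an explicit quadratic barrier. -/
theorem harmonic_le_quadratic_of_eq_zero {h : E → ℝ} {e : E} (he : ‖e‖ = 1) {ρ d : ℝ}
    (hρ : 0 < ρ) (hd : 0 < d)
    (hC : ∀ w ∈ Metric.closedBall (0 : E) ρ, ContDiffAt ℝ 2 h w)
    (hΔ : ∀ w ∈ Metric.closedBall (0 : E) ρ, Laplacian.laplacian h w = 0)
    (h0 : ∀ w, inner ℝ w e = 0 → h w = 0)
    (hle : ∀ w ∈ Metric.closedBall (0 : E) ρ, h w ≤ d)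
    {w : E} (hw : w ∈ Metric.closedBall (0 : E) ρ) (hwe : 0 ≤ inner ℝ w e) :
    h w ≤ d / ρ ^ 2 * ‖w‖ ^ 2 + (finrank ℝ E + 1) * (d / ρ) * inner ℝ w e
      - (finrank ℝ E + 1) * (d / ρ ^ 2) * inner ℝ w e ^ 2 := by
  set N : ℝ := (finrank ℝ E : ℝ) with hN
  have hN0 : 0 ≤ N := Nat.cast_nonneg _
  -- With t = ⟨y, e⟩, these coefficients make the barrier K‖y‖² ≥ 0 on the flat face and d + M t (ρ
  -- - t) ≥ d on the sphere, with Laplacian -2K < 0. Hence `h - B` has no positive maximum.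
  set K := d / ρ ^ 2 with hK
  set L := (N + 1) * (d / ρ) with hL
  set M := (N + 1) * K with hM
  have hK0 : 0 < K := by positivity
  have hM0 : 0 < M := by positivity
  have hLM : L = M * ρ := by rw [hL, hM, hK]; field_simp
  have hKρ : K * ρ ^ 2 = d := by rw [hK]; field_simp
  set B : E → ℝ := fun y => K * ‖y‖ ^ 2 + L * inner ℝ y e - M * inner ℝ y e ^ 2 with hB
  have hBc : ContDiff ℝ 2 B := contDiff_quadratic K L M e
  set S : Set E := Metric.closedBall (0 : E) ρ ∩ {y | 0 ≤ inner ℝ y e} with hS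
  have hinner : Continuous fun y : E => inner ℝ y e := continuous_id.inner continuous_const
  have hScomp : IsCompact S :=
    (isCompact_closedBall _ _).inter_right (isClosed_le continuous_const hinner)
  have hcont : ContinuousOn (h - B) S := fun y hy =>
    ((hC y hy.1).continuousAt.sub hBc.continuous.continuousAt).continuousWithinAt
  obtain ⟨z, hzS, hz⟩ := hScomp.exists_isMaxOn ⟨w, hw, hwe⟩ hcont
  suffices hz0 : h z - B z ≤ 0 by
    have := hz (show w ∈ S from ⟨hw, hwe⟩)
    simp only [mem_ofPred_eq, Pi.sub_apply] at this
    have : h w ≤ B w := by linarith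
    exact this
  have hzn : ‖z‖ ≤ ρ := by simpa using hzS.1
  have hze : 0 ≤ inner ℝ z e := hzS.2
  have hzeρ : inner ℝ z e ≤ ρ := by
    have := real_inner_le_norm z e
    rw [he, mul_one] at this
    linarith
  by_contra! hpos
  rcases hze.eq_or_lt with hflat | hze'
  · have : B z = K * ‖z‖ ^ 2 := by simp [hB, ← hflat]
    have hKz : 0 ≤ K * ‖z‖ ^ 2 := by positivity
    rw [h0 z hflat.symm] at hpos
    linarith
  rcases hzn.eq_or_lt with hround | hzn'
  · have : B z = d + M * inner ℝ z e * (ρ - inner ℝ z e) := by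
      simp only [hB, hround, hKρ, hLM]; ring
    have h2 : 0 ≤ M * inner ℝ z e * (ρ - inner ℝ z e) :=
      mul_nonneg (by positivity) (by linarith)
    have := hle z hzS.1
    linarith
  have hnhds : S ∈ 𝓝 z := by
    refine Filter.inter_mem (Metric.closedBall_mem_nhds_of_mem (by simpa using hzn')) ?_
    filter_upwards [hinner.continuousAt.eventually (lt_mem_nhds hze')] with y hy using hy.le
  have hlap := laplacian_nonpos_of_isLocalMax ((hC z hzS.1).sub hBc.contDiffAt)
    (hz.isLocalMax hnhds)
  have heq : Laplacian.laplacian (h - B) z = 0 - (2 * K * N - 2 * M) := by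
    rw [(hC z hzS.1).laplacian_sub hBc.contDiffAt, hΔ z hzS.1, laplacian_quadratic K L M he]
  change Laplacian.laplacian (h - B) z ≤ 0 at hlap
  rw [heq, hM] at hlap
  nlinarith

/-- Interior Lipschitz estimate for bounded harmonic functions. -/
theorem harmonic_sub_le {v : E → ℝ} {p y : E} {R d : ℝ} (hR : 0 < R) (hd : 0 < d)
    (hv : HarmonicOnNhd v (Metric.closedBall p R))
    (h0 : ∀ x ∈ Metric.closedBall p R, 0 ≤ v x) (h1 : ∀ x ∈ Metric.closedBall p R, v x ≤ d)
    (hy : ‖y - p‖ ≤ R / 2) :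
    v y - v p ≤ (finrank ℝ E + 1) * (d / R) * ‖y - p‖ := by
  rcases eq_or_ne y p with rfl | hyp
  · simp
  have hnorm : 0 < ‖y - p‖ := norm_pos_iff.mpr (sub_ne_zero.mpr hyp)
  set s := ‖y - p‖ / 2 with hs
  set e := ‖y - p‖⁻¹ • (y - p) with he
  have he1 : ‖e‖ = 1 := by
    rw [he, norm_smul, norm_inv, norm_norm, inv_mul_cancel₀ hnorm.ne']
  have hse : s • e = (1 / 2 : ℝ) • (y - p) := by
    rw [he, smul_smul, hs]; congr 1; field_simp
  -- Reflect about the midpoint z of p and y. The difference v(z + w) - v(z + σ w) is harmonic,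
  -- vanishes on the mirror, and equals v y - v p at w = s • e, so the half-ball barrier bounds it.
  set z := p + s • e with hz
  set σ : E ≃ₗᵢ[ℝ] E := (ℝ ∙ e)ᗮ.reflection with hσ
  have hσe : σ e = -e := Submodule.reflection_orthogonalComplement_singleton_eq_neg e
  have hball : ∀ w : E, ‖w‖ ≤ R / 2 → z + w ∈ Metric.closedBall p R := by
    intro w hw
    have : ‖s • e‖ ≤ R / 4 := by
      rw [norm_smul, he1, Real.norm_of_nonneg (by positivity)]; linarith
    rw [mem_closedBall_iff_norm, hz]
    calc ‖p + s • e + w - p‖ = ‖s • e + w‖ := by congr 1; abel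
      _ ≤ ‖s • e‖ + ‖w‖ := norm_add_le _ _
      _ ≤ R := by linarith
  have hball' : ∀ w : E, ‖w‖ ≤ R / 2 → z + σ w ∈ Metric.closedBall p R := fun w hw =>
    hball _ (by rwa [LinearIsometryEquiv.norm_map])
  have hid : ∀ w : E, ‖w‖ ≤ R / 2 → ContDiffAt ℝ 2 (fun w => v (z + w)) w ∧
      Laplacian.laplacian (fun w => v (z + w)) w = 0 := by
    intro w hw
    have hh := hv _ (hball w hw)
    refine ⟨ContDiffAt.comp w (f := fun y => z + y) hh.1 (by fun_prop), ?_⟩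
    have := laplacian_comp_add_isometry z (LinearIsometryEquiv.refl ℝ E) (x := w) (f := v)
      (by simpa using hh.1)
    simp only [LinearIsometryEquiv.coe_refl, id_eq] at this
    rw [this]
    exact hh.2.eq_of_nhds
  have hrefl : ∀ w : E, ‖w‖ ≤ R / 2 → ContDiffAt ℝ 2 (fun w => v (z + σ w)) w ∧
      Laplacian.laplacian (fun w => v (z + σ w)) w = 0 := by
    intro w hw
    have hh := hv _ (hball' w hw)
    refine ⟨ContDiffAt.comp w (f := fun y => z + σ y) hh.1
      (contDiff_const.add σ.toContinuousLinearEquiv.contDiff).contDiffAt, ?_⟩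
    rw [laplacian_comp_add_isometry z σ hh.1]
    exact hh.2.eq_of_nhds
  have hsn : ‖s • e‖ = s := by
    rw [norm_smul, he1, mul_one, Real.norm_of_nonneg (by positivity)]
  have hse1 : inner ℝ (s • e) e = s := by
    rw [inner_smul_left, real_inner_self_eq_norm_sq, he1]; simp
  have main := harmonic_le_quadratic_of_eq_zero
    (h := (fun w => v (z + w)) - fun w => v (z + σ w)) he1 (half_pos hR) hd
    (fun w hw => (hid w (by simpa using hw)).1.sub (hrefl w (by simpa using hw)).1)
    (fun w hw => by
      have hw' : ‖w‖ ≤ R / 2 := by simpa using hw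
      rw [(hid w hw').1.laplacian_sub (hrefl w hw').1, (hid w hw').2, (hrefl w hw').2, sub_zero])
    (fun w hw => by
      have : σ w = w := Submodule.reflection_mem_subspace_eq_self
        (Submodule.mem_orthogonal_singleton_iff_inner_left.mpr hw)
      simp [this])
    (fun w hw => by
      have hw' : ‖w‖ ≤ R / 2 := by simpa using hw
      have := h1 _ (hball w hw')
      have := h0 _ (hball' w hw')
      simp only [Pi.sub_apply]
      linarith)
    (w := s • e) (by simp only [mem_closedBall_zero_iff, hsn]; linarith)
    (by rw [hse1]; positivity)
  have e1 : z + s • e = y := by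
    rw [hz, add_assoc, hse, ← add_smul]; norm_num
  have e2 : z + σ (s • e) = p := by
    rw [map_smul, hσe, hz]; simp
  simp only [Pi.sub_apply, e1, e2, hsn, hse1] at main
  have hN0 : (0 : ℝ) ≤ (finrank ℝ E : ℝ) := Nat.cast_nonneg _
  have hq : 0 ≤ (finrank ℝ E : ℝ) * (d / (R / 2) ^ 2 * s ^ 2) := by positivity
  have hlin : ((finrank ℝ E : ℝ) + 1) * (d / (R / 2)) * s
      = (finrank ℝ E + 1) * (d / R) * ‖y - p‖ := by
    rw [hs]; field_simp
  linarith

end InteriorEstimate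

/-! ### Comparison of viscosity solutions with strict sub- and supersolutions -/

section Comparison

open InnerProductSpace Module

variable {E : Type*} [NormedAddCommGroup E] [InnerProductSpace ℝ E]

omit [InnerProductSpace ℝ E] in
theorem isOpen_posSet {G : Type*} [NormedAddCommGroup G]
    {Ω : Set E} (hΩ : IsOpen Ω) {U : E → G} (hU : ContinuousOn U Ω) :
    IsOpen (posSet Ω U) :=
  hU.norm.isOpen_inter_preimage hΩ isOpen_Ioi

omit [InnerProductSpace ℝ E] in
theorem posSet_union_freeBoundary {G : Type*} [NormedAddCommGroup G]
    (Ω : Set E) (U : E → G) :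
    posSet Ω U ∪ freeBoundary Ω U = Ω ∩ closure (posSet Ω U) := by
  have hsub : posSet Ω U ⊆ Ω := fun x hx => hx.1
  rw [closure_eq_self_union_frontier, inter_union_distrib_left, inter_eq_right.mpr hsub]
  rfl

omit [InnerProductSpace ℝ E] in
theorem eq_zero_of_mem_freeBoundary {G : Type*} [NormedAddCommGroup G]
    {Ω : Set E} (hΩ : IsOpen Ω) {U : E → G}
    (hU : ContinuousOn U Ω) {x : E} (hx : x ∈ freeBoundary Ω U) : U x = 0 := by
  by_contra hne
  have hpos : x ∈ posSet Ω U := ⟨hx.1, norm_pos_iff.mpr hne⟩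
  have := (isOpen_posSet hΩ hU).frontier_eq ▸ hx.2
  exact this.2 hpos

variable [FiniteDimensional ℝ E]

theorem harmonicAt_inner_right {m : ℕ} {U : E → EuclideanSpace ℝ (Fin m)} {x : E}
    (h : ∀ i, HarmonicAt (fun y => U y i) x) (f : EuclideanSpace ℝ (Fin m)) :
    HarmonicAt (fun y => inner ℝ (U y) f) x := by
  have hsum : ∀ s : Finset (Fin m), HarmonicAt (fun y => ∑ i ∈ s, f i * U y i) x := by
    intro s
    induction s using Finset.induction_on with
    | empty => simp
    | insert i s hi ih =>
      have := ((h i).const_smul (c := f i)).add ih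
      refine (harmonicAt_congr_nhds (Eventually.of_forall fun y => ?_)).mp this
      simp [Finset.sum_insert hi]
  refine (harmonicAt_congr_nhds (Eventually.of_forall fun y => ?_)).mp (hsum Finset.univ)
  simp [PiLp.inner_apply]

variable {m : ℕ} {Ω : Set E} {U : E → EuclideanSpace ℝ (Fin m)}

/-- Outside the closure of the positivity set U vanishes locally. Thus a subsolution can be compared
with a component on the whole of a compact set, not only where |U| > 0. -/
theorem IsViscositySolution.harmonicAt_of_notMem_freeBoundary (hU : IsViscositySolution Ω U)
    (hΩ : IsOpen Ω) {x : E} (hx : x ∈ Ω) (hxF : x ∉ freeBoundary Ω U) (i : Fin m) :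
    HarmonicAt (fun y => U y i) x := by
  by_cases hpos : x ∈ posSet Ω U
  · exact hU.harmonic i x hpos
  have hcl : x ∉ closure (posSet Ω U) := fun h => by
    have : x ∈ posSet Ω U ∪ freeBoundary Ω U := by
      rw [posSet_union_freeBoundary]; exact ⟨hx, h⟩
    exact this.elim hpos hxF
  refine (harmonicAt_congr_nhds ?_).mp (harmonicAt_const (x := x) (0 : ℝ))
  filter_upwards [hΩ.mem_nhds hx, isClosed_closure.isOpen_compl.mem_nhds hcl] with y hy hy'
  have : U y = 0 := by
    by_contra hne
    exact hy' (subset_closure ⟨hy, norm_pos_iff.mpr hne⟩)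
  simp [this]

/-- Strict subsolutions lie below every component of a viscosity solution, provided they do so
on the boundary of a compact set. -/
theorem IsViscositySolution.strict_subsolution_le (hU : IsViscositySolution Ω U)
    (hΩ : IsOpen Ω) {K : Set E} (hK : IsCompact K) (hKΩ : K ⊆ Ω) (i : Fin m) {w : E → ℝ}
    (hw : ContDiff ℝ 2 w)
    (h : ∀ x ∈ K, w x ≤ U x i ∨ (K ∈ 𝓝 x ∧ 0 < Laplacian.laplacian w x ∧
      (x ∈ freeBoundary Ω U → 1 < ‖gradient w x‖))) :
    ∀ x ∈ K, w x ≤ U x i := by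
  intro x hx
  have hcoord : Continuous fun y : EuclideanSpace ℝ (Fin m) => y i := by fun_prop
  have hcont : ContinuousOn (fun y => U y i - w y) K :=
    (hcoord.comp_continuousOn (hU.continuousOn.mono hKΩ)).sub hw.continuous.continuousOn
  obtain ⟨z, hzK, hz⟩ := hK.exists_isMinOn ⟨x, hx⟩ hcont
  suffices hz0 : w z ≤ U z i by
    have h1 : U z i - w z ≤ U x i - w x := hz hx
    linarith
  rcases h z hzK with h1 | ⟨hnhds, hlap, hgrad⟩
  · exact h1
  exfalso
  have hmin : ∀ᶠ y in 𝓝 z, U z i - w z ≤ U y i - w y := by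
    filter_upwards [hnhds] with y hy using hz hy
  by_cases hF : z ∈ freeBoundary Ω U
  · refine hU.not_touches_below z hF (fun y => w y + (U z i - w z))
      (hw.contDiffAt.add contDiffAt_const) ?_ (EuclideanSpace.single i 1) (by simp) ⟨?_, ?_⟩
    · simp only [gradient, fderiv_add_const]
      exact hgrad hF
    · simp [EuclideanSpace.inner_single_right]
    · filter_upwards [hmin] with y hy
      simp [EuclideanSpace.inner_single_right]
      linarith
  · refine not_isLocalMax_sub_of_harmonicAt hw.contDiffAt hlap
      (hU.harmonicAt_of_notMem_freeBoundary hΩ (hKΩ hzK) hF i) ?_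
    filter_upwards [hmin] with y hy
    simp only [Pi.sub_apply]
    linarith

/-- Strict supersolutions lie above the norm of a viscosity solution on the closure of the
positivity set, provided they do so on the boundary of a compact set. -/
theorem IsViscositySolution.norm_le_strict_supersolution (hU : IsViscositySolution Ω U)
    (hΩ : IsOpen Ω) {K : Set E} (hK : IsCompact K) (hKΩ : K ⊆ Ω) {w : E → ℝ}
    (hw : ContDiff ℝ 2 w)
    (h : ∀ x ∈ K, x ∈ posSet Ω U ∪ freeBoundary Ω U → ‖U x‖ ≤ w x ∨
      (K ∈ 𝓝 x ∧ Laplacian.laplacian w x < 0 ∧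
      (x ∈ freeBoundary Ω U → gradient w x ≠ 0 ∧ ‖gradient w x‖ < 1))) :
    ∀ x ∈ K, x ∈ posSet Ω U ∪ freeBoundary Ω U → ‖U x‖ ≤ w x := by
  intro x hx hxD
  rw [posSet_union_freeBoundary] at hxD
  -- The minimum is taken only over the closure of the positivity set: elsewhere U vanishes and w
  -- may be negative.
  have hcont : ContinuousOn (fun y => w y - ‖U y‖) (K ∩ closure (posSet Ω U)) :=
    hw.continuous.continuousOn.sub
      (hU.continuousOn.mono (inter_subset_left.trans hKΩ)).norm
  obtain ⟨z, ⟨hzK, hzcl⟩, hz⟩ :=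
    (hK.inter_right isClosed_closure).exists_isMinOn ⟨x, hx, hxD.2⟩ hcont
  suffices hz0 : ‖U z‖ ≤ w z by
    have h1 : w z - ‖U z‖ ≤ w x - ‖U x‖ := hz ⟨hx, hxD.2⟩
    linarith
  have hzD : z ∈ posSet Ω U ∪ freeBoundary Ω U := by
    rw [posSet_union_freeBoundary]; exact ⟨hKΩ hzK, hzcl⟩
  rcases h z hzK hzD with h1 | ⟨hnhds, hlap, hgrad⟩
  · exact h1
  exfalso
  have hmin : ∀ᶠ y in 𝓝 z, y ∈ closure (posSet Ω U) → w z - ‖U z‖ ≤ w y - ‖U y‖ := by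
    filter_upwards [hnhds] with y hy hycl using hz ⟨hy, hycl⟩
  rcases hzD with hpos | hF
  · have hev : ∀ᶠ y in 𝓝 z, w z - ‖U z‖ ≤ w y - ‖U y‖ := by
      filter_upwards [hmin, (isOpen_posSet hΩ hU.continuousOn).mem_nhds hpos] with y hy hyp
        using hy (subset_closure hyp)
    -- ‖U‖ need not be harmonic, but the component of U along U z / ‖U z‖ is. It lies below ‖U‖ and
    -- agrees with it at z, so the contact passes to it.
    set f := (‖U z‖)⁻¹ • U z with hf
    have hf1 : ‖f‖ = 1 := by
      rw [hf, norm_smul, norm_inv, norm_norm, inv_mul_cancel₀ hpos.2.ne']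
    have hfz : inner ℝ (U z) f = ‖U z‖ := by
      rw [hf, inner_smul_right, real_inner_self_eq_norm_sq]
      have := hpos.2.ne'
      field_simp
    have hharm := harmonicAt_inner_right (fun i => hU.harmonic i z hpos) f
    have hlapneg : 0 < Laplacian.laplacian (-w) z := by
      rw [laplacian_neg]; simpa using hlap
    refine not_isLocalMax_sub_of_harmonicAt hw.contDiffAt.neg hlapneg hharm.neg ?_
    filter_upwards [hev] with y hy
    have : inner ℝ (U y) f ≤ ‖U y‖ := by
      simpa [hf1] using real_inner_le_norm (U y) f
    simp only [Pi.sub_apply, Pi.neg_apply, hfz]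
    linarith
  · have hUz : U z = 0 := eq_zero_of_mem_freeBoundary hΩ hU.continuousOn hF
    refine hU.not_touches_above z hF (fun y => w y - w z) (hw.contDiffAt.sub contDiffAt_const)
      ?_ ?_ ⟨?_, ?_⟩
    · simp only [gradient, fderiv_sub_const]
      exact (hgrad hF).1
    · simp only [gradient, fderiv_sub_const]
      exact (hgrad hF).2
    · simp [hUz]
    · filter_upwards [hmin, hΩ.mem_nhds hF.1] with y hy hyΩ
      by_cases hycl : y ∈ closure (posSet Ω U)
      · have := hy hycl
        rw [hUz, norm_zero] at this
        exact le_max_of_le_left (by linarith)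
      · have : ‖U y‖ ≤ 0 := by
          by_contra! hpos
          exact hycl (subset_closure ⟨hyΩ, hpos⟩)
        exact le_max_of_le_right this

end Comparison

/-! ### Gaussian barriers and their gradients -/

section Barrier

open InnerProductSpace Module

variable {E : Type*} [NormedAddCommGroup E] [InnerProductSpace ℝ E] [FiniteDimensional ℝ E]

/-- The affine function `⟨x, e⟩ + c` perturbed by `s` times a Gaussian bump centred at `p` which
vanishes at distance `3 r / 4` from `p`. -/
noncomputable def barrier (A r s c : ℝ) (e p x : E) : ℝ :=
  inner ℝ x e + c + s * (Real.exp (-(A / r ^ 2) * ‖x - p‖ ^ 2) - Real.exp (-(A * (9 / 16))))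

omit [FiniteDimensional ℝ E] in
theorem contDiff_barrier (A r s c : ℝ) (e p : E) : ContDiff ℝ 2 (barrier A r s c e p) :=
  ((contDiff_id.inner ℝ contDiff_const).add contDiff_const).add
    (contDiff_const.mul ((contDiff_gaussian _ p).sub contDiff_const))

theorem laplacian_barrier (A r s c : ℝ) (e p x : E) :
    Laplacian.laplacian (barrier A r s c e p) x = s * (2 * (A / r ^ 2) *
      (2 * (A / r ^ 2) * ‖x - p‖ ^ 2 - finrank ℝ E) *
        Real.exp (-(A / r ^ 2) * ‖x - p‖ ^ 2)) := by
  have hfun : barrier A r s c e p =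
      (fun x => inner ℝ x e + (c - s * Real.exp (-(A * (9 / 16))))) +
        s • (fun x => Real.exp (-(A / r ^ 2) * ‖x - p‖ ^ 2)) := by
    ext x; simp [barrier]; ring
  rw [hfun, ContDiffAt.laplacian_add, laplacian_inner_add_const, laplacian_smul,
    laplacian_gaussian]
  · rw [smul_eq_mul, zero_add]; ring
  · exact (contDiff_gaussian _ p).contDiffAt
  · exact (harmonicAt_inner_add_const e _ x).1
  · exact contDiffAt_const.smul (contDiff_gaussian _ p).contDiffAt

theorem gradient_barrier (A r s c : ℝ) (e p x : E) :
    gradient (barrier A r s c e p) x =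
      e - (s * (2 * (A / r ^ 2)) * Real.exp (-(A / r ^ 2) * ‖x - p‖ ^ 2)) • (x - p) := by
  refine HasGradientAt.gradient ?_
  rw [hasGradientAt_iff_hasFDerivAt]
  have h1 : HasFDerivAt (fun x : E => inner ℝ x e) (innerSL ℝ e) x := by
    refine ((innerSL ℝ e).hasFDerivAt (x := x)).congr_of_eventuallyEq
      (Eventually.of_forall fun y => ?_)
    simp [real_inner_comm]
  have h2 : HasFDerivAt (fun x : E => ‖x - p‖ ^ 2) (2 • (innerSL ℝ (x - p))) x := by
    have := ((hasFDerivAt_id x).sub_const p).norm_sq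
    simpa using this
  have h3 := (h1.add_const c).add
    ((((h2.const_mul (-(A / r ^ 2))).exp).sub_const (Real.exp (-(A * (9 / 16))))).const_mul s)
  refine h3.congr_fderiv ?_
  ext y
  simp
  ring

omit [FiniteDimensional ℝ E] in
theorem barrier_eq_of_norm_eq {A r s c : ℝ} {e p x : E} (hr : 0 < r)
    (hx : ‖x - p‖ = 3 / 4 * r) : barrier A r s c e p x = inner ℝ x e + c := by
  have : -(A / r ^ 2) * ‖x - p‖ ^ 2 = -(A * (9 / 16)) := by
    rw [hx]; field_simp; ring
  rw [barrier, this]; ring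

omit [FiniteDimensional ℝ E] [InnerProductSpace ℝ E] in
theorem gaussian_bump_le_one {A r : ℝ} (hA : 0 ≤ A) (p x : E) :
    Real.exp (-(A / r ^ 2) * ‖x - p‖ ^ 2) - Real.exp (-(A * (9 / 16))) ≤ 1 := by
  have h1 : Real.exp (-(A / r ^ 2) * ‖x - p‖ ^ 2) ≤ 1 := by
    rw [Real.exp_le_one_iff, neg_mul]
    exact neg_nonpos.mpr (by positivity)
  have := Real.exp_pos (-(A * (9 / 16)))
  linarith

omit [FiniteDimensional ℝ E] [InnerProductSpace ℝ E] in
theorem gaussian_bump_ge {A r : ℝ} (hA : 0 ≤ A) (hr : 0 < r) {p x : E}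
    (hx : ‖x - p‖ ≤ 5 / 8 * r) :
    Real.exp (-(A * (25 / 64))) - Real.exp (-(A * (9 / 16))) ≤
      Real.exp (-(A / r ^ 2) * ‖x - p‖ ^ 2) - Real.exp (-(A * (9 / 16))) := by
  gcongr
  rw [neg_mul]
  refine neg_le_neg ?_
  calc A / r ^ 2 * ‖x - p‖ ^ 2 ≤ A / r ^ 2 * (5 / 8 * r) ^ 2 := by gcongr
    _ = A * (25 / 64) := by field_simp; ring

/-- The gradient is e - β(x - p) with β > 0, and its component along e, 1 - β⟨x - p, e⟩, already
exceeds 1. -/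
theorem one_lt_norm_gradient_barrier {A r s : ℝ} (c : ℝ) {e p x : E} (hA : 0 < A) (hr : 0 < r)
    (hs : 0 < s) (he : ‖e‖ = 1) (hx : inner ℝ (x - p) e < 0) :
    1 < ‖gradient (barrier A r s c e p) x‖ := by
  rw [gradient_barrier]
  set β := s * (2 * (A / r ^ 2)) * Real.exp (-(A / r ^ 2) * ‖x - p‖ ^ 2)
  have hβ : 0 < β := by positivity
  have h1 : inner ℝ (e - β • (x - p)) e = 1 - β * inner ℝ (x - p) e := by
    rw [inner_sub_left, inner_smul_left, real_inner_self_eq_norm_sq, he]; simp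
  have h2 := real_inner_le_norm (e - β • (x - p)) e
  rw [h1, he, mul_one] at h2
  nlinarith

/-- The gradient is e + β(x - p), with squared norm 1 + 2β⟨x - p, e⟩ + β²‖x - p‖². The linear term
is at most -βr/8, while `hsA` gives βr ≤ 1/16: the quadratic term is then at most βr/16, and the
perturbation is too short to cancel e. -/
theorem gradient_barrier_ne_zero_and_norm_lt_one {A r s : ℝ} (c : ℝ) {e p x : E} (hA : 0 < A)
    (hr : 0 < r) (hs : 0 < s) (hsA : 32 * (A * s) ≤ r) (he : ‖e‖ = 1) (hxr : ‖x - p‖ ≤ r)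
    (hx : inner ℝ (x - p) e ≤ -(r / 16)) :
    gradient (barrier A r (-s) c e p) x ≠ 0 ∧ ‖gradient (barrier A r (-s) c e p) x‖ < 1 := by
  rw [gradient_barrier]
  set β := s * (2 * (A / r ^ 2)) * Real.exp (-(A / r ^ 2) * ‖x - p‖ ^ 2) with hβdef
  have hβ : 0 < β := by positivity
  have hval : -s * (2 * (A / r ^ 2)) * Real.exp (-(A / r ^ 2) * ‖x - p‖ ^ 2) = -β := by
    rw [hβdef]; ring
  rw [hval, neg_smul, sub_neg_eq_add]
  have hβr : β * r ≤ 1 / 16 := by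
    have hexp : Real.exp (-(A / r ^ 2) * ‖x - p‖ ^ 2) ≤ 1 := by
      rw [Real.exp_le_one_iff, neg_mul]
      exact neg_nonpos.mpr (by positivity)
    calc β * r ≤ s * (2 * (A / r ^ 2)) * 1 * r := by rw [hβdef]; gcongr
      _ = 2 * (A * s) / r := by field_simp
      _ ≤ 1 / 16 := by rw [div_le_iff₀ hr]; linarith
  have hq : ‖β • (x - p)‖ ≤ β * r := by
    rw [norm_smul, Real.norm_of_nonneg hβ.le]; gcongr
  constructor
  · intro h0
    have h1 : ‖e‖ = ‖β • (x - p)‖ := by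
      rw [eq_neg_of_add_eq_zero_left h0, norm_neg]
    rw [he] at h1
    linarith
  · have h1 : ‖e + β • (x - p)‖ ^ 2
        = 1 + 2 * (β * inner ℝ (x - p) e) + ‖β • (x - p)‖ ^ 2 := by
      rw [norm_add_sq_real, he, inner_smul_right, real_inner_comm]; ring
    have h2 : ‖β • (x - p)‖ ^ 2 ≤ (β * r) ^ 2 := by gcongr
    have h3 : β * inner ℝ (x - p) e ≤ β * -(r / 16) := by gcongr
    have h4 : (β * r) ^ 2 ≤ 1 / 16 * (β * r) := by
      rw [sq]; gcongr
    have h5 : 0 < β * r := by positivity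
    have : ‖e + β • (x - p)‖ ^ 2 < 1 := by rw [h1]; linarith
    nlinarith [norm_nonneg (e + β • (x - p))]

end Barrier

/-! ### One step of the partial Harnack inequality -/

section Harnack

open InnerProductSpace Module

variable {E : Type*} [NormedAddCommGroup E] [InnerProductSpace ℝ E] [FiniteDimensional ℝ E]

/-- One step of the improvement of flatness: if `⟨x, e⟩ + a ≤ uⁱ` and `|U| ≤ ⟨x, e⟩ + b` in the
ball of radius `r`, then one of the two bounds improves by a fixed fraction of `b - a` in the
ball of radius `r / 2`. -/
theorem exists_harnack_constants (E : Type*) [NormedAddCommGroup E] [InnerProductSpace ℝ E]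
    [FiniteDimensional ℝ E] :
    ∃ c ε₁ : ℝ, 0 < c ∧ c ≤ 1 / 8 ∧ 0 < ε₁ ∧
      ∀ {m : ℕ} {Ω : Set E} {U : E → EuclideanSpace ℝ (Fin m)} (i : Fin m) {e x₀ : E}
        {r a b τ : ℝ}, IsViscositySolution Ω U → IsOpen Ω → ‖e‖ = 1 → 0 < r →
        Metric.ball x₀ r ⊆ Ω → x₀ ∈ posSet Ω U ∪ freeBoundary Ω U →
        a < b → b - a ≤ ε₁ * r →
        (∀ x ∈ Ω, ‖U x‖ ^ 2 ≤ U x i ^ 2 + τ ^ 2) → 128 * τ ^ 2 ≤ (b - a) * r →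
        (∀ x ∈ Metric.ball x₀ r, inner ℝ x e + a ≤ U x i) →
        (∀ x ∈ Metric.ball x₀ r, x ∈ posSet Ω U ∪ freeBoundary Ω U →
          ‖U x‖ ≤ inner ℝ x e + b) →
        ∃ a' b' : ℝ, b' - a' = (1 - c) * (b - a) ∧
          (∀ x ∈ Metric.ball x₀ (r / 2), inner ℝ x e + a' ≤ U x i) ∧
          (∀ x ∈ Metric.ball x₀ (r / 2), x ∈ posSet Ω U ∪ freeBoundary Ω U →
            ‖U x‖ ≤ inner ℝ x e + b') := by
  set N : ℝ := (finrank ℝ E : ℝ) with hN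
  have hN0 : 0 ≤ N := Nat.cast_nonneg _
  set κ : ℝ := 1 / (128 * (N + 1)) with hκ
  have hκ0 : 0 < κ := by positivity
  have hκ1 : κ ≤ 1 / 128 := by
    rw [hκ]; exact one_div_le_one_div_of_le (by norm_num) (by linarith)
  -- Large enough that the Gaussian is strictly subharmonic outside the ball of radius κr.
  set A : ℝ := N / (2 * κ ^ 2) + 1 with hA
  have hA1 : 1 ≤ A := by
    have : 0 ≤ N / (2 * κ ^ 2) := by positivity
    linarith
  have hA0 : 0 < A := by linarith
  have hAκ : N < 2 * A * κ ^ 2 := by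
    have : 2 * A * κ ^ 2 = N + 2 * κ ^ 2 := by rw [hA]; field_simp
    have : 0 < κ ^ 2 := by positivity
    linarith
  set c₀ : ℝ := Real.exp (-(A * (25 / 64))) - Real.exp (-(A * (9 / 16))) with hc₀
  have hc₀pos : 0 < c₀ := by
    rw [hc₀, sub_pos, Real.exp_lt_exp]; linarith
  have hc₀le : c₀ ≤ 1 := by
    have h1 : Real.exp (-(A * (25 / 64))) ≤ 1 := Real.exp_le_one_iff.mpr (by linarith)
    have := Real.exp_pos (-(A * (9 / 16)))
    linarith
  refine ⟨c₀ / 8, 1 / (32 * A), by positivity, by linarith, by positivity, ?_⟩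
  intro m Ω U i e x₀ r a b τ hU hΩ he hr hball hx₀ hab hflat hτ hτδ hlow hup
  set δ := b - a with hδ
  have hδ0 : 0 < δ := sub_pos.mpr hab
  have hAδ : 32 * (A * δ) ≤ r := by
    have : 32 * A * δ ≤ 32 * A * (1 / (32 * A) * r) := by gcongr
    have h2 : 32 * A * (1 / (32 * A) * r) = r := by field_simp
    linarith
  have hδr : 32 * δ ≤ r := by
    have := mul_le_mul_of_nonneg_right hA1 hδ0.le
    linarith
  have hAs : 32 * (A * (δ / 8)) ≤ r := by linarith
  have hκr : κ * r ≤ 1 / 128 * r := mul_le_mul_of_nonneg_right hκ1 hr.le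
  set p := x₀ + (r / 8) • e with hp
  have hpx₀ : ‖p - x₀‖ = r / 8 := by
    rw [hp, add_sub_cancel_left, norm_smul, he, mul_one, Real.norm_of_nonneg (by positivity)]
  -- Here x₀ lying in the closure of the positivity set matters: |U| ≥ 0 keeps x₀ from being far
  -- below the upper plane's zero level, so p is well inside the positivity set.
  have hx₀e : -b ≤ inner ℝ x₀ e := by
    have := hup x₀ (Metric.mem_ball_self hr) hx₀
    linarith [norm_nonneg (U x₀)]
  have hpe : r / 8 - b ≤ inner ℝ p e := by
    rw [hp, inner_add_left, inner_smul_left, real_inner_self_eq_norm_sq, he]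
    simp
    linarith
  have hsub : ∀ x : E, ‖x - p‖ ≤ 3 / 4 * r → x ∈ Metric.ball x₀ r := fun x hx => by
    rw [mem_ball_iff_norm]
    have := norm_sub_le_norm_sub_add_norm_sub x p x₀
    linarith
  have hsubhalf : ∀ x ∈ Metric.ball x₀ (r / 2), ‖x - p‖ ≤ 5 / 8 * r := fun x hx => by
    rw [mem_ball_iff_norm] at hx
    have := norm_sub_le_norm_sub_add_norm_sub x x₀ p
    rw [norm_sub_rev x₀ p] at this
    linarith
  have hint : ∀ x ∈ Metric.closedBall p (r / 32), r / 16 ≤ U x i := fun x hx => by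
    rw [mem_closedBall_iff_norm] at hx
    have h1 := abs_le.mp (abs_real_inner_le_norm (x - p) e)
    rw [he, mul_one, inner_sub_left] at h1
    have := hlow x (hsub x (by linarith))
    linarith [h1.1]
  have hcoord : ∀ x, U x i ≤ ‖U x‖ := fun x =>
    (le_abs_self _).trans (PiLp.norm_apply_le (U x) i)
  have hintpos : Metric.closedBall p (r / 32) ⊆ posSet Ω U := fun x hx => by
    refine ⟨hball (hsub x ?_), ?_⟩
    · rw [mem_closedBall_iff_norm] at hx; linarith
    · have := hint x hx
      have := hcoord x
      linarith
  set v : E → ℝ := fun x => U x i - (inner ℝ x e + a) with hv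
  have hvharm : HarmonicOnNhd v (Metric.closedBall p (r / 32)) := fun x hx =>
    (hU.harmonic i x (hintpos hx)).sub (harmonicAt_inner_add_const e a x)
  have hv0 : ∀ x ∈ Metric.closedBall p (r / 32), 0 ≤ v x := fun x hx => by
    rw [mem_closedBall_iff_norm] at hx
    have := hlow x (hsub x (by linarith))
    simp only [hv]; linarith
  have hv1 : ∀ x ∈ Metric.closedBall p (r / 32), v x ≤ δ := fun x hx => by
    have hxD := hintpos hx
    rw [mem_closedBall_iff_norm] at hx
    have := hup x (hsub x (by linarith)) (Or.inl hxD)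
    have := hcoord x
    simp only [hv]; linarith
  have hosc : ∀ y : E, ‖y - p‖ ≤ κ * r → |v y - v p| ≤ δ / 4 := fun y hy => by
    have hy' : ‖y - p‖ ≤ r / 32 / 2 := by linarith
    have hbd : (N + 1) * (δ / (r / 32)) * ‖y - p‖ ≤ δ / 4 := by
      calc (N + 1) * (δ / (r / 32)) * ‖y - p‖ ≤ (N + 1) * (δ / (r / 32)) * (κ * r) := by gcongr
        _ = δ / 4 := by rw [hκ]; field_simp; norm_num
    have h1 := harmonic_sub_le (by positivity) hδ0 hvharm hv0 hv1 hy'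
    -- Applying the estimate to δ - v gives the reverse inequality.
    have h2 := harmonic_sub_le (v := (fun _ => δ) - v) (by positivity) hδ0
      (fun x hx => (harmonicAt_const δ).sub (hvharm x hx))
      (fun x hx => sub_nonneg.mpr (hv1 x hx)) (fun x hx => sub_le_self _ (hv0 x hx)) hy'
    simp only [Pi.sub_apply] at h2
    rw [abs_le]
    constructor <;> linarith
  -- U = 0 and the lower plane force free boundary points below p in the direction e, where both
  -- gradient lemmas apply.
  have hFe : ∀ x ∈ Metric.ball x₀ r, x ∈ freeBoundary Ω U → inner ℝ (x - p) e ≤ -(r / 16) := by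
    intro x hx hxF
    have h1 := hlow x hx
    rw [eq_zero_of_mem_freeBoundary hΩ hU.continuousOn hxF] at h1
    rw [inner_sub_left]
    simp at h1
    linarith
  have hKΩ : Metric.closedBall p (3 / 4 * r) ⊆ Ω := fun x hx =>
    hball (hsub x (mem_closedBall_iff_norm.mp hx))
  have hlap : ∀ (c' : ℝ) (x : E), κ * r < ‖x - p‖ → ∀ s, ∃ q, 0 < q ∧
      Laplacian.laplacian (barrier A r s c' e p) x = s * q := by
    intro c' x hx s
    refine ⟨_, ?_, laplacian_barrier A r s c' e p x⟩
    have h1 : (κ * r) ^ 2 < ‖x - p‖ ^ 2 := by gcongr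
    have h2 : 2 * (A / r ^ 2) * (κ * r) ^ 2 = 2 * A * κ ^ 2 := by field_simp
    have h3 : 2 * (A / r ^ 2) * (κ * r) ^ 2 < 2 * (A / r ^ 2) * ‖x - p‖ ^ 2 := by gcongr
    have h4 : 0 < 2 * (A / r ^ 2) * ‖x - p‖ ^ 2 - N := by linarith
    positivity
  have hs0 : 0 < δ / 8 := by positivity
  rcases le_total (δ / 2) (v p) with hcase | hcase
  · refine ⟨a + c₀ / 8 * δ, b, by rw [hδ]; ring, fun x hx => ?_, fun x hx hxD =>
      hup x (Metric.ball_subset_ball (by linarith) hx) hxD⟩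
    have hx58 := hsubhalf x hx
    have hcomp := hU.strict_subsolution_le hΩ (isCompact_closedBall p (3 / 4 * r)) hKΩ i
      (contDiff_barrier A r (δ / 8) a e p) (fun y hy => ?_) x
      (mem_closedBall_iff_norm.mpr (by linarith))
    · refine le_trans ?_ hcomp
      have := mul_le_mul_of_nonneg_left (gaussian_bump_ge hA0.le hr hx58) hs0.le
      rw [barrier]
      linarith
    · rw [mem_closedBall_iff_norm] at hy
      rcases le_or_gt ‖y - p‖ (κ * r) with hin | hout
      · left
        have h1 := (abs_le.mp (hosc y hin)).1
        have h2 := mul_le_mul_of_nonneg_left (gaussian_bump_le_one (r := r) hA0.le p y) hs0.le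
        have h3 : v y = U y i - (inner ℝ y e + a) := rfl
        rw [barrier]
        linarith
      rcases hy.eq_or_lt with hbd | hlt
      · left
        rw [barrier_eq_of_norm_eq hr hbd]
        exact hlow y (hsub y hbd.le)
      · right
        refine ⟨Metric.closedBall_mem_nhds_of_mem (mem_ball_iff_norm.mpr hlt), ?_, fun hyF => ?_⟩
        · obtain ⟨q, hq, heq⟩ := hlap a y hout (δ / 8)
          rw [heq]; positivity
        · have := hFe y (hsub y hlt.le) hyF
          exact one_lt_norm_gradient_barrier a hA0 hr hs0 he (by linarith)
  · refine ⟨a, b - c₀ / 8 * δ, by rw [hδ]; ring, fun x hx =>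
      hlow x (Metric.ball_subset_ball (by linarith) hx), fun x hx hxD => ?_⟩
    have hx58 := hsubhalf x hx
    have hcomp := hU.norm_le_strict_supersolution hΩ (isCompact_closedBall p (3 / 4 * r)) hKΩ
      (contDiff_barrier A r (-(δ / 8)) b e p) (fun y hy hyD => ?_) x
      (mem_closedBall_iff_norm.mpr (by linarith)) hxD
    · refine hcomp.trans ?_
      have := mul_le_mul_of_nonneg_left (gaussian_bump_ge hA0.le hr hx58) hs0.le
      rw [barrier]
      linarith
    · rw [mem_closedBall_iff_norm] at hy
      rcases le_or_gt ‖y - p‖ (κ * r) with hin | hout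
      · left
        have h1 := (abs_le.mp (hosc y hin)).2
        have h2 := mul_le_mul_of_nonneg_left (gaussian_bump_le_one (r := r) hA0.le p y) hs0.le
        have h3 : v y = U y i - (inner ℝ y e + a) := rfl
        have h4 : r / 16 ≤ U y i := hint y (mem_closedBall_iff_norm.mpr (by linarith))
        -- Since uⁱ ≥ r/16, the cross term uⁱδ/4 of (uⁱ + δ/8)² absorbs τ² ≤ δr/128. Together with v
        -- ≤ 3δ/4 this leaves a margin δ/8 below the upper plane.
        have h5 : ‖U y‖ ≤ U y i + δ / 8 := by
          have h6 := hτ y (hKΩ (mem_closedBall_iff_norm.mpr hy))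
          refine le_of_sq_le_sq (h6.trans ?_) (by linarith)
          have h7 : r / 16 * δ ≤ U y i * δ := mul_le_mul_of_nonneg_right h4 hδ0.le
          have h8 : (U y i + δ / 8) ^ 2 = U y i ^ 2 + U y i * δ / 4 + (δ / 8) ^ 2 := by ring
          rw [h8]
          linarith [sq_nonneg τ, sq_nonneg (δ / 8)]
        rw [barrier]
        linarith
      rcases hy.eq_or_lt with hbd | hlt
      · left
        rw [barrier_eq_of_norm_eq hr hbd]
        exact hup y (hsub y hbd.le) hyD
      · right
        refine ⟨Metric.closedBall_mem_nhds_of_mem (mem_ball_iff_norm.mpr hlt), ?_, fun hyF => ?_⟩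
        · obtain ⟨q, hq, heq⟩ := hlap b y hout (-(δ / 8))
          rw [heq, neg_mul]; exact neg_neg_of_pos (mul_pos hs0 hq)
        · exact gradient_barrier_ne_zero_and_norm_lt_one b hA0 hr hs0 hAs he
            (by linarith) (hFe y (hsub y hlt.le) hyF)

end Harnack

/-! ### From flatness to iterated bounds on dyadic balls -/

section Iteration

variable {n m : ℕ}

theorem inner_single_last (x : EuclideanSpace ℝ (Fin (n + 1))) :
    inner ℝ x (EuclideanSpace.single (Fin.last n) (1 : ℝ)) = lastCoord x := by
  simp [EuclideanSpace.inner_single_right, lastCoord]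

theorem IsFlat.abs_sub_le {ε : ℝ}
    {U : EuclideanSpace ℝ (Fin (n + 1)) → EuclideanSpace ℝ (Fin (m + 1))} (h : IsFlat ε U)
    {x : EuclideanSpace ℝ (Fin (n + 1))} (hx : x ∈ Metric.ball 0 1) :
    |U x 0 - max (lastCoord x) 0| ≤ ε := by
  have := PiLp.norm_apply_le
    (U x - max (lastCoord x) 0 • EuclideanSpace.single (0 : Fin (m + 1)) (1 : ℝ)) 0
  refine le_trans ?_ (this.trans (h x hx))
  simp

theorem IsFlat.norm_le {ε : ℝ}
    {U : EuclideanSpace ℝ (Fin (n + 1)) → EuclideanSpace ℝ (Fin (m + 1))} (h : IsFlat ε U)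
    {x : EuclideanSpace ℝ (Fin (n + 1))} (hx : x ∈ Metric.ball 0 1) :
    ‖U x‖ ≤ max (lastCoord x) 0 + ε := by
  have h1 := norm_sub_norm_le (U x)
    (max (lastCoord x) 0 • EuclideanSpace.single (0 : Fin (m + 1)) (1 : ℝ))
  have h2 : ‖max (lastCoord x) 0 • EuclideanSpace.single (0 : Fin (m + 1)) (1 : ℝ)‖
      = max (lastCoord x) 0 := by
    rw [norm_smul]
    simp
  linarith [h x hx]

/-- The model x_n⁺ f¹ has only a first component, so the other components of U have total square at
most ε². -/
theorem IsFlat.norm_sq_le {ε : ℝ}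
    {U : EuclideanSpace ℝ (Fin (n + 1)) → EuclideanSpace ℝ (Fin (m + 1))} (h : IsFlat ε U)
    {x : EuclideanSpace ℝ (Fin (n + 1))} (hx : x ∈ Metric.ball 0 1) :
    ‖U x‖ ^ 2 ≤ U x 0 ^ 2 + ε ^ 2 := by
  have h1 : ‖U x - max (lastCoord x) 0 • EuclideanSpace.single (0 : Fin (m + 1)) (1 : ℝ)‖ ^ 2
      ≤ ε ^ 2 := by
    gcongr
    exact h x hx
  rw [EuclideanSpace.real_norm_sq_eq, Fin.sum_univ_succ] at h1
  rw [EuclideanSpace.real_norm_sq_eq, Fin.sum_univ_succ]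
  simp at h1
  linarith [sq_nonneg (U x 0 - max (lastCoord x) 0)]

theorem neg_le_lastCoord {ε : ℝ}
    {U : EuclideanSpace ℝ (Fin (n + 1)) → EuclideanSpace ℝ (Fin (m + 1))}
    (hv : VanishesBelow ε U) {x : EuclideanSpace ℝ (Fin (n + 1))}
    (hx : x ∈ posSet (Metric.ball 0 1) U ∪ freeBoundary (Metric.ball 0 1) U) :
    -ε ≤ lastCoord x := by
  rw [posSet_union_freeBoundary] at hx
  have hclosed : IsClosed {y : EuclideanSpace ℝ (Fin (n + 1)) | -ε ≤ lastCoord y} :=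
    isClosed_le continuous_const (by unfold lastCoord; fun_prop)
  refine hclosed.closure_subset_iff.mpr (fun y hy => ?_) hx.2
  by_contra hlt
  exact hy.2.ne' (hv y hy.1 (not_le.mp hlt))

/-- Flatness of order `ε` traps the graph between two translates of the half-plane solution. -/
theorem IsFlat.bounds {ε : ℝ} (hε : 0 < ε)
    {U : EuclideanSpace ℝ (Fin (n + 1)) → EuclideanSpace ℝ (Fin (m + 1))} (h : IsFlat ε U)
    (hv : VanishesBelow ε U) :
    (∀ x ∈ Metric.ball 0 1, lastCoord x + -ε ≤ U x 0) ∧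
      ∀ x ∈ posSet (Metric.ball 0 1) U ∪ freeBoundary (Metric.ball 0 1) U,
        ‖U x‖ ≤ lastCoord x + 2 * ε := by
  refine ⟨fun x hx => ?_, fun x hx => ?_⟩
  · have := (abs_le.mp (h.abs_sub_le hx)).1
    linarith [le_max_left (lastCoord x) 0]
  · have h1 := neg_le_lastCoord hv hx
    rw [posSet_union_freeBoundary] at hx
    refine (h.norm_le hx.1).trans ?_
    have : max (lastCoord x) 0 ≤ lastCoord x + ε := max_le (by linarith) (by linarith)
    linarith

/-- Iterated improvement of flatness around a fixed point, as long as the scale is large compared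
with the flatness. -/
theorem exists_iterated_bounds (n : ℕ) : ∃ c c₂ : ℝ, 0 < c ∧ c ≤ 1 / 8 ∧ 0 < c₂ ∧
    ∀ {m : ℕ} {ε : ℝ}, 0 < ε →
    ∀ {U : EuclideanSpace ℝ (Fin (n + 1)) → EuclideanSpace ℝ (Fin (m + 1))},
    IsViscositySolution (Metric.ball 0 1) U → IsFlat ε U → VanishesBelow ε U →
    ∀ x₀ ∈ Metric.ball (0 : EuclideanSpace ℝ (Fin (n + 1))) (1 / 2) ∩
      (posSet (Metric.ball 0 1) U ∪ freeBoundary (Metric.ball 0 1) U),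
    ∀ k : ℕ, ε * 4 ^ k ≤ c₂ → ∃ a b : ℝ, b - a = 3 * ε * (1 - c) ^ k ∧
      (∀ x ∈ Metric.ball x₀ (1 / 2 ^ (k + 1)), lastCoord x + a ≤ U x 0) ∧
      ∀ x ∈ Metric.ball x₀ (1 / 2 ^ (k + 1)),
        x ∈ posSet (Metric.ball 0 1) U ∪ freeBoundary (Metric.ball 0 1) U →
        ‖U x‖ ≤ lastCoord x + b := by
  obtain ⟨c, ε₁, hc0, hc1, hε₁, hstep⟩ :=
    exists_harnack_constants (EuclideanSpace ℝ (Fin (n + 1)))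
  refine ⟨c, min (ε₁ / 6) (1 / 128), hc0, hc1, by positivity, ?_⟩
  intro m ε hε U hU hflat hvan x₀ hx₀ k
  have hball : ∀ k : ℕ, Metric.ball x₀ (1 / 2 ^ (k + 1)) ⊆ Metric.ball 0 1 := fun k => by
    have h1 : (1 : ℝ) / 2 ^ (k + 1) ≤ 1 / 2 := by
      rw [pow_succ]
      have : (1 : ℝ) ≤ 2 ^ k := one_le_pow₀ (by norm_num)
      exact one_div_le_one_div_of_le (by norm_num) (by linarith)
    refine Metric.ball_subset_ball' ?_
    have := Metric.mem_ball.mp hx₀.1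
    linarith
  induction k with
  | zero =>
    intro _
    obtain ⟨h1, h2⟩ := hflat.bounds hε hvan
    exact ⟨-ε, 2 * ε, by ring, fun x hx => h1 x (hball 0 hx), fun x _ hxD => h2 x hxD⟩
  | succ k ih =>
    intro hk
    have h4 : (1 : ℝ) ≤ 4 ^ k := one_le_pow₀ (by norm_num)
    have h2pos : (0 : ℝ) < 2 ^ k := by positivity
    have h24 : (2 : ℝ) ^ k ≤ 4 ^ k := pow_le_pow_left₀ (by norm_num) (by norm_num) k
    have h22 : (2 : ℝ) ^ k * 2 ^ k = 4 ^ k := by rw [← mul_pow]; norm_num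
    have hk' : ε * 4 ^ k ≤ min (ε₁ / 6) (1 / 128) := by
      refine le_trans ?_ hk
      gcongr
      · norm_num
      · omega
    obtain ⟨a, b, hab, hlow, hup⟩ := ih hk'
    have hpow0 : 0 < (1 - c) ^ k := pow_pos (by linarith) k
    have hpow1 : (1 - c) ^ k ≤ 1 := pow_le_one₀ (by linarith) (by linarith)
    -- As 1 - c ≥ 1/2, the gap decays no faster than the radius; this keeps it above the ε² error in
    -- `hτ`.
    have hpow2 : 1 / 2 ^ k ≤ (1 - c) ^ k := by
      rw [← one_div_pow]
      exact pow_le_pow_left₀ (by norm_num) (by linarith) k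
    have hr : (0 : ℝ) < 1 / 2 ^ (k + 1) := by positivity
    have hflat' : b - a ≤ ε₁ * (1 / 2 ^ (k + 1)) := by
      rw [hab, mul_one_div, le_div_iff₀ (by positivity), pow_succ]
      have h6 := hk'.trans (min_le_left _ _)
      calc 3 * ε * (1 - c) ^ k * (2 ^ k * 2) ≤ 3 * ε * 1 * (4 ^ k * 2) := by gcongr
        _ ≤ ε₁ := by linarith
    have hτ : 128 * ε ^ 2 ≤ (b - a) * (1 / 2 ^ (k + 1)) := by
      have h6 := hk'.trans (min_le_right _ _)
      calc 128 * ε ^ 2 = ε * (128 * (ε * 4 ^ k)) / 4 ^ k := by field_simp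
        _ ≤ ε * (3 / 2) / 4 ^ k := by gcongr; linarith
        _ = 3 * ε * (1 / 2 ^ k) * (1 / 2 ^ (k + 1)) := by
          rw [← h22, pow_succ]; field_simp
        _ ≤ 3 * ε * (1 - c) ^ k * (1 / 2 ^ (k + 1)) := by gcongr
        _ = (b - a) * (1 / 2 ^ (k + 1)) := by rw [hab]
    have hhalf : (1 : ℝ) / 2 ^ (k + 1) / 2 = 1 / 2 ^ (k + 1 + 1) := by
      rw [pow_succ _ (k + 1)]; field_simp
    obtain ⟨a', b', hab', hlow', hup'⟩ := hstep (0 : Fin (m + 1))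
      (e := EuclideanSpace.single (Fin.last n) (1 : ℝ)) (τ := ε) hU Metric.isOpen_ball (by simp)
      hr (hball k) hx₀.2 (sub_pos.mp (by rw [hab]; positivity)) hflat'
      (fun x hx => hflat.norm_sq_le hx) hτ
      (fun x hx => by rw [inner_single_last]; exact hlow x hx)
      (fun x hx hxD => by rw [inner_single_last]; exact hup x hx hxD)
    simp only [inner_single_last, hhalf] at hlow' hup'
    exact ⟨a', b', by rw [hab', hab]; ring, hlow', hup'⟩

/-- Since u¹ ≤ |U|, both functions lie between the same two planes, so one gap controls both
oscillations. -/
theorem abs_rescaled_sub_le {ε a b : ℝ} (hε : 0 < ε)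
    {U : EuclideanSpace ℝ (Fin (n + 1)) → EuclideanSpace ℝ (Fin (m + 1))}
    {x x₀ : EuclideanSpace ℝ (Fin (n + 1))}
    (hx : lastCoord x + a ≤ U x 0) (hx' : ‖U x‖ ≤ lastCoord x + b)
    (hx₀ : lastCoord x₀ + a ≤ U x₀ 0) (hx₀' : ‖U x₀‖ ≤ lastCoord x₀ + b) :
    |rescaledFirst ε U x - rescaledFirst ε U x₀| ≤ (b - a) / ε ∧
      |rescaledNorm ε U x - rescaledNorm ε U x₀| ≤ (b - a) / ε := by
  have h1 : U x 0 ≤ ‖U x‖ := (le_abs_self _).trans (PiLp.norm_apply_le (U x) 0)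
  have h2 : U x₀ 0 ≤ ‖U x₀‖ := (le_abs_self _).trans (PiLp.norm_apply_le (U x₀) 0)
  simp only [rescaledFirst, rescaledNorm, ← sub_div, abs_div, abs_of_pos hε]
  constructor <;> gcongr <;> rw [abs_le] <;> constructor <;> linarith

end Iteration

end VectorialBernoulli

/-! ### From geometric decay to the Hölder modulus -/

theorem corollary2p3 (n m : ℕ) :
    ∃ (εbar C α : ℝ) (r : ℝ → ℝ), 0 < εbar ∧ 0 < C ∧ 0 < α ∧ α < 1 ∧
      (∀ ε : ℝ, 0 < ε → 0 < r ε) ∧ Tendsto r (𝓝[>] 0) (𝓝 0) ∧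
      ∀ (ε : ℝ), 0 < ε → ε ≤ εbar →
      ∀ U : EuclideanSpace ℝ (Fin (n + 1)) → EuclideanSpace ℝ (Fin (m + 1)),
        VectorialBernoulli.IsViscositySolution (Metric.ball 0 1) U →
        VectorialBernoulli.IsFlat ε U →
        VectorialBernoulli.VanishesBelow ε U →
        ∀ x₀ ∈ Metric.ball (0 : EuclideanSpace ℝ (Fin (n + 1))) (1 / 2) ∩
            (VectorialBernoulli.posSet (Metric.ball 0 1) U ∪
              VectorialBernoulli.freeBoundary (Metric.ball 0 1) U),
          VectorialBernoulli.HolderAtOutside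
            (VectorialBernoulli.posSet (Metric.ball 0 1) U ∪
              VectorialBernoulli.freeBoundary (Metric.ball 0 1) U)
            (VectorialBernoulli.rescaledFirst ε U) C α (r ε) x₀ ∧
          VectorialBernoulli.HolderAtOutside
            (VectorialBernoulli.posSet (Metric.ball 0 1) U ∪
              VectorialBernoulli.freeBoundary (Metric.ball 0 1) U)
            (VectorialBernoulli.rescaledNorm ε U) C α (r ε) x₀ := by
  obtain ⟨c, c₂, hc0, hc1, hc₂, hiter⟩ := VectorialBernoulli.exists_iterated_bounds n
  set α : ℝ := -Real.logb 2 (1 - c) with hα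
  have hα0 : 0 < α := by
    rw [hα, neg_pos]
    exact Real.logb_neg (by norm_num) (by linarith) (by linarith)
  have hα1 : α < 1 := by
    rw [hα, neg_lt, Real.lt_logb_iff_rpow_lt (by norm_num) (by linarith), Real.rpow_neg_one]
    linarith
  have hpow : ((1 : ℝ) / 2) ^ α = 1 - c := by
    rw [hα, one_div, Real.inv_rpow (by norm_num), ← Real.rpow_neg (by norm_num), neg_neg,
      Real.rpow_logb (by norm_num) (by norm_num) (by linarith)]
  -- The radius encodes ε 4^k ≤ c₂ at scale 2^(-k), so the threshold 1 is an arbitrary choice. The 3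
  -- is the initial gap (from -ε to 2ε) divided by ε; the 8 comes from the choice of k below.
  refine ⟨1, 3 * 8 ^ α, α, fun ε => √(ε / c₂), one_pos, by positivity, hα0, hα1,
    fun ε hε => Real.sqrt_pos.mpr (by positivity), ?_, ?_⟩
  · have hcont : Continuous fun ε : ℝ => √(ε / c₂) := by fun_prop
    have := hcont.tendsto 0
    simp only [zero_div, Real.sqrt_zero] at this
    exact this.mono_left nhdsWithin_le_nhds
  intro ε hε _ U hU hflat hvan x₀ hx₀
  suffices key : ∀ x ∈ VectorialBernoulli.posSet (Metric.ball 0 1) U ∪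
      VectorialBernoulli.freeBoundary (Metric.ball 0 1) U, √(ε / c₂) ≤ ‖x - x₀‖ →
      |VectorialBernoulli.rescaledFirst ε U x - VectorialBernoulli.rescaledFirst ε U x₀|
          ≤ 3 * 8 ^ α * ‖x - x₀‖ ^ α ∧
        |VectorialBernoulli.rescaledNorm ε U x - VectorialBernoulli.rescaledNorm ε U x₀|
          ≤ 3 * 8 ^ α * ‖x - x₀‖ ^ α from
    ⟨fun x hx hxr => (key x hx hxr).1, fun x hx hxr => (key x hx hxr).2⟩
  intro x hx hxr
  set ρ := ‖x - x₀‖ with hρ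
  have hρ0 : 0 < ρ := (Real.sqrt_pos.mpr (div_pos hε hc₂)).trans_le hxr
  have hC : 3 * (8 : ℝ) ^ α * ρ ^ α = 3 * (8 * ρ) ^ α := by
    rw [Real.mul_rpow (by norm_num) hρ0.le]; ring
  rw [hC]
  have hmem : ∀ y ∈ VectorialBernoulli.posSet (Metric.ball 0 1) U ∪
      VectorialBernoulli.freeBoundary (Metric.ball 0 1) U, y ∈ Metric.ball 0 1 := fun y hy =>
    hy.elim (fun h => h.1) (fun h => h.1)
  rcases le_or_gt ρ (1 / 4) with hsmall | hlarge
  -- The factor 4 gives ρ ≤ 2^(-k)/4, strictly inside the ball of radius 2^(-(k+1)), while 2^(-k) <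
  -- 8ρ.
  · obtain ⟨k, hk1, hk2⟩ := exists_nat_pow_near_of_lt_one (x := 4 * ρ) (y := 1 / 2)
      (by positivity) (by linarith) (by norm_num) (by norm_num)
    have hεk : ε * 4 ^ k ≤ c₂ := by
      have h1 : ε ≤ c₂ * ρ ^ 2 := by
        rw [Real.sqrt_le_left hρ0.le, div_le_iff₀ hc₂] at hxr
        linarith
      have h2 : ρ * 2 ^ k ≤ 1 := by
        rw [one_div_pow, le_div_iff₀ (by positivity)] at hk2
        have : 0 < ρ * 2 ^ k := by positivity
        linarith
      have h3 : (2 : ℝ) ^ k * 2 ^ k = 4 ^ k := by rw [← mul_pow]; norm_num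
      calc ε * 4 ^ k ≤ c₂ * ρ ^ 2 * 4 ^ k := by gcongr
        _ = c₂ * (ρ * 2 ^ k) ^ 2 := by rw [← h3]; ring
        _ ≤ c₂ * 1 ^ 2 := by gcongr
        _ = c₂ := by ring
    obtain ⟨a, b, hab, hlow, hup⟩ := hiter hε hU hflat hvan x₀ hx₀ k hεk
    have hr : (0 : ℝ) < 1 / 2 ^ (k + 1) := by positivity
    have hxball : x ∈ Metric.ball x₀ (1 / 2 ^ (k + 1)) := by
      rw [mem_ball_iff_norm, ← hρ, ← one_div_pow, pow_succ]
      linarith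
    have hbound := VectorialBernoulli.abs_rescaled_sub_le hε (hlow x hxball) (hup x hxball hx)
      (hlow x₀ (Metric.mem_ball_self hr)) (hup x₀ (Metric.mem_ball_self hr) hx₀.2)
    have hdecay : (b - a) / ε ≤ 3 * (8 * ρ) ^ α := by
      calc (b - a) / ε = 3 * (1 - c) ^ k := by rw [hab]; field_simp
        _ = 3 * ((1 / 2) ^ k) ^ α := by
          rw [← hpow, ← Real.rpow_natCast, ← Real.rpow_natCast, ← Real.rpow_mul (by norm_num),
            ← Real.rpow_mul (by norm_num), mul_comm α]
        _ ≤ 3 * (8 * ρ) ^ α := by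
          gcongr
          rw [pow_succ] at hk1
          linarith
    exact ⟨hbound.1.trans hdecay, hbound.2.trans hdecay⟩
  -- At distances above 1/4 the initial bound 3 suffices, because 8ρ > 1.
  · obtain ⟨hlow, hup⟩ := hflat.bounds hε hvan
    have hbound := VectorialBernoulli.abs_rescaled_sub_le hε (hlow x (hmem x hx)) (hup x hx)
      (hlow x₀ (hmem x₀ hx₀.2)) (hup x₀ hx₀.2)
    have hdecay : (2 * ε - -ε) / ε ≤ 3 * (8 * ρ) ^ α := by
      have h1 : (2 * ε - -ε) / ε = 3 := by field_simp; norm_num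
      have h2 : 1 ≤ (8 * ρ) ^ α := Real.one_le_rpow (by linarith) hα0.le
      rw [h1]; linarith
    exact ⟨hbound.1.trans hdecay, hbound.2.trans hdecay⟩
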